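/- **Setting.** Tensors carry the Frobenius inner product and norm; $\odot$ and powers such as $\sqrt{\mathcal W}$, $\mathcal W^{-1}$ of tensors are component-wise. For fourth order tensors $[\mathcal G]\in\mathbb R^{n_1\times n_2\times n_3\times N}$ and stacks of matrices $[X]\in\mathbb R^{m\times n\times N}$ all operations (products, transposes, the mode-$i$ unfolding $(\cdot)_{[(i)]}$, the mode products $\times_i$, projections onto the Stiefel manifold) act separately on each of the $N$ slices along the last index. Let $\mathbb S_{m,n}=\{X\in\mathbb R^{m\times n}: X^\top X=\mathbf I_n\}$, and let $m_i\ge n_i$, $i=1,2,3$. Let $\mathcal D\in\mathbb R^{I_1\times I_2\times I_3}$, let $\delta,\gamma>0$, $p\in(0,1)$, $w\in\mathbb R^N_{++}$, and let $\mathbf R:\mathbb R^{I_1\times I_2\times I_3}\to\mathbb R^{m_1\times m_2\times m_3\times N}$ be linear with transpose $\mathbf R^\top$ such that $\mathbf R^\top\mathbf R(\mathcal T)=\mathcal W\odot\mathcal T$ for all $\mathcal T$, where $\mathcal W\in\mathbb R^{I_1\times I_2\times I_3}$ has positive entries. Put $$\varphi(\mathcal S)=\|\mathcal S\|_{2,p}^p=\sum_{i_2,i_3}\Big(\sum_{i_1}s_{i_1i_2i_3}^2\Big)^{p/2},\qquad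 \psi([\mathcal G])=\sum_{j=1}^N w_j\big\|[\mathcal G]^{(j)}\big\|_1 ,$$ where $\|\cdot\|_1$ is the sum of the absolute values of the entries. The model is $$\min\ \tfrac\delta2\|\mathbf R(\mathcal L+\mathcal S-\mathcal D)\|_F^2+\gamma\,\varphi(\sqrt{\mathcal W}\odot\mathcal S)+\psi([\mathcal G])+\tfrac12\|\mathbf R(\mathcal L)-[\mathcal G]\times_1[X_1]\times_2[X_2]\times_3[X_3]\|_F^2$$ over $\mathcal Z=(\mathcal S,[X_1],[X_2],[X_3],[\mathcal G],\mathcal L)$, where $\mathcal S,\mathcal L\in\mathbb R^{I_1\times I_2\times I_3}$, $[\mathcal G]\in\mathbb R^{n_1\times n_2\times n_3\times N}$ and $[X_i]\in\mathbb R^{m_i\times n_i\times N}$, subject to $[X_i]^\top[X_i]=[\mathbf I_{n_i}]$, $i=1,2,3$. For $f:\mathbb R^d\to\mathbb R$ and $\lambda>0$ let $\operatorname{prox}_{\lambda f}(x)=\arg\min_u\{f(u)+\frac1{2\lambda}\|u-x\|^2\}$ (a set). The Fréchet subdifferential $\hat\partial f(x)$ is the set of $u$ with $\liminf_{y\to x,\,y\ne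 x}\frac{f(y)-f(x)-\langle u,y-x\rangle}{\|y-x\|}\ge0$, and the limiting subdifferential $\partial f(x)$ is the set of limits of sequences $u^k\in\hat\partial f(x^k)$ with $x^k\to x$ and $f(x^k)\to f(x)$. $\operatorname{Proj}_{\mathbb S_{m,n}}(A)$ is the set of all points of $\mathbb S_{m,n}$ nearest to $A$ in Frobenius norm. **Algorithm (P-BCD).** Let $\alpha_{\mathcal S},\alpha_X,\alpha_{\mathcal G}>0$. The initial point $\mathcal Z^0$ is arbitrary except that $[X_i^0]$ consists of matrices in $\mathbb S_{m_i,n_i}$. For $k=0,1,2,\dots$, with $\tilde\alpha_{\mathcal S}=\frac{\delta}{\delta+\alpha_{\mathcal S}}$, $\tilde\gamma=\frac{\gamma}{\delta+\alpha_{\mathcal S}}$, $\tilde\alpha_X=\frac1{1+\alpha_X}$, $\tilde\alpha_{\mathcal G}=\frac1{1+\alpha_{\mathcal G}}$, $\tilde\delta=\frac1{1+\delta}$: $$\mathcal S^{k+1}\in(\sqrt{\mathcal W})^{-1}\odot\operatorname{prox}_{\tilde\gamma\varphi}\big[\sqrt{\mathcal W}\odot(\mathcal S^k-\tilde\alpha_{\mathcal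 S}(\mathcal S^k+\mathcal L^k-\mathcal D))\big],$$ $$[X_i^{k+1}]\in\operatorname{Proj}_{[\mathbb S_{m_i,n_i}]}\big([X_i^k]-\tilde\alpha_X([X_i^k]-[P_i^k][Q_i^k]^\top)\big),\quad i=1,2,3,$$ $$[\mathcal G^{k+1}]\in\operatorname{prox}_{\tilde\alpha_{\mathcal G}\psi}\big([\mathcal G^k]-\tilde\alpha_{\mathcal G}([\mathcal G^k]-[\mathcal O^{k+1}])\big),$$ $$\mathcal L^{k+1}=\tilde\delta\,\mathcal W^{-1}\odot\mathbf R^\top([\mathcal Y^{k+1}])+(1-\tilde\delta)(\mathcal D-\mathcal S^{k+1}),$$ where $[P_i^k]=(\mathbf R(\mathcal L^k))_{[(i)]}$, $[Q_1^k]=([\mathcal G^k]\times_2[X_2^k]\times_3[X_3^k])_{[(1)]}$, $[Q_2^k]=([\mathcal G^k]\times_1[X_1^{k+1}]\times_3[X_3^k])_{[(2)]}$, $[Q_3^k]=([\mathcal G^k]\times_1[X_1^{k+1}]\times_2[X_2^{k+1}])_{[(3)]}$, $[\mathcal O^{k+1}]=\mathbf R(\mathcal L^k)\times_1[X_1^{k+1}]^\top\times_2[X_2^{k+1}]^\top\times_3[X_3^{k+1}]^\top$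 and $[\mathcal Y^{k+1}]=[\mathcal G^{k+1}]\times_1[X_1^{k+1}]\times_2[X_2^{k+1}]\times_3[X_3^{k+1}]$. **First-order stationary point.** $\bar{\mathcal Z}=(\bar{\mathcal S},[\bar X_1],[\bar X_2],[\bar X_3],[\bar{\mathcal G}],\bar{\mathcal L})$ is a first-order stationary point of the model if, for $i=1,2,3$, $$\begin{aligned} &0\in\delta(\bar{\mathcal L}+\bar{\mathcal S}-\mathcal D)+\gamma(\sqrt{\mathcal W})^{-1}\odot\partial\varphi(\sqrt{\mathcal W}\odot\bar{\mathcal S}),\\ &0=([\mathbf I_{m_i}]-[\bar X_i][\bar X_i]^\top)[\bar H_i],\qquad 0=[\bar H_i]^\top[\bar X_i]-[\bar X_i]^\top[\bar H_i],\qquad [\bar X_i]^\top[\bar X_i]=[\mathbf I_{n_i}],\\ &0\in[\bar{\mathcal G}]-[\bar{\mathcal O}]+\partial\psi([\bar{\mathcal G}]),\\ &0=\delta(\bar{\mathcal L}+\bar{\mathcal S}-\mathcal D)+\bar{\mathcal L}-\mathcal W^{-1}\odot\mathbf R^\top([\bar{\mathcal Y}]), \end{aligned}$$ where $[\bar P_i]$,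 $[\bar Q_i]$, $[\bar{\mathcal O}]$, $[\bar{\mathcal Y}]$ are given by the formulas above with every iterate replaced by the corresponding component of $\bar{\mathcal Z}$, and $[\bar H_i]=([\bar X_i][\bar Q_i]-[\bar P_i])[\bar Q_i]^\top$. **Theorem.** Let $\{\mathcal Z^k\}_{k\ge0}$ be a sequence generated by the P-BCD algorithm. Then every accumulation point of $\{\mathcal Z^k\}$ is a first-order stationary point of the model. -/

import Mathlib

open Filter Topology Matrix

/-! ### Tensors with the Frobenius inner product, and stacks of matrices -/

/-- Third order real tensors, with the Frobenius inner product and norm. -/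
abbrev Tensor3 (a b c : ℕ) : Type := EuclideanSpace ℝ (Fin a × Fin b × Fin c)

/-- Fourth order real tensors, with the Frobenius inner product and norm. The entry `(i₁, i₂, i₃, j)`
is the entry `(i₁, i₂, i₃)` of the `j`-th independent third order tensor of the stack. -/
abbrev Tensor4 (a b c N : ℕ) : Type := EuclideanSpace ℝ (Fin a × Fin b × Fin c × Fin N)

/-- Stacks of `N` independent `m × n` matrices. -/
abbrev MatStack (m n N : ℕ) : Type := Fin N → Matrix (Fin m) (Fin n) ℝ

/-- Component-wise product. -/
def tmul {ι : Type*} (A B : EuclideanSpace ℝ ι) : EuclideanSpace ℝ ι :=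
  WithLp.toLp 2 (fun i => A i * B i)

/-- Component-wise square root. -/
noncomputable def tsqrt {ι : Type*} (A : EuclideanSpace ℝ ι) : EuclideanSpace ℝ ι :=
  WithLp.toLp 2 (fun i => Real.sqrt (A i))

/-- Component-wise inverse. -/
noncomputable def tinv {ι : Type*} (A : EuclideanSpace ℝ ι) : EuclideanSpace ℝ ι :=
  WithLp.toLp 2 (fun i => (A i)⁻¹)

/-- `[G] ×₁ [X]`, performed independently for each `j`. -/
def modeProd1 {a b c N a' : ℕ} (G : Tensor4 a b c N) (X : MatStack a' a N) : Tensor4 a' b c N :=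
  WithLp.toLp 2 (fun q => ∑ s : Fin a, X q.2.2.2 q.1 s * G (s, q.2.1, q.2.2.1, q.2.2.2))

/-- `[G] ×₂ [X]`, performed independently for each `j`. -/
def modeProd2 {a b c N b' : ℕ} (G : Tensor4 a b c N) (X : MatStack b' b N) : Tensor4 a b' c N :=
  WithLp.toLp 2 (fun q => ∑ s : Fin b, X q.2.2.2 q.2.1 s * G (q.1, s, q.2.2.1, q.2.2.2))

/-- `[G] ×₃ [X]`, performed independently for each `j`. -/
def modeProd3 {a b c N c' : ℕ} (G : Tensor4 a b c N) (X : MatStack c' c N) : Tensor4 a b c' N :=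
  WithLp.toLp 2 (fun q => ∑ s : Fin c, X q.2.2.2 q.2.2.1 s * G (q.1, q.2.1, s, q.2.2.2))

/-- `[X]ᵀ`, performed independently for each `j`. -/
def stackT {m n N : ℕ} (X : MatStack m n N) : MatStack n m N := fun j => (X j)ᵀ

/-- Independent mode-1 unfolding. The columns are indexed by the pair of the remaining indices
(instead of a linear enumeration of these pairs, which is immaterial in products `P * Qᵀ`). -/
def unfold1 {a b c N : ℕ} (T : Tensor4 a b c N) (j : Fin N) :
    Matrix (Fin a) (Fin b × Fin c) ℝ :=
  Matrix.of (fun i₁ q => T (i₁, q.1, q.2, j))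

/-- Independent mode-2 unfolding. -/
def unfold2 {a b c N : ℕ} (T : Tensor4 a b c N) (j : Fin N) :
    Matrix (Fin b) (Fin a × Fin c) ℝ :=
  Matrix.of (fun i₂ q => T (q.1, i₂, q.2, j))

/-- Independent mode-3 unfolding. -/
def unfold3 {a b c N : ℕ} (T : Tensor4 a b c N) (j : Fin N) :
    Matrix (Fin c) (Fin a × Fin b) ℝ :=
  Matrix.of (fun i₃ q => T (q.1, q.2, i₃, j))

/-! ### The two nonsmooth terms -/

/-- The tensor `ℓ_{2,p}` (quasi-)norm. -/
noncomputable def l2pNorm {a b c : ℕ} (p : ℝ) (S : Tensor3 a b c) : ℝ :=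
  (∑ i₃ : Fin c, ∑ i₂ : Fin b, (∑ i₁ : Fin a, S (i₁, i₂, i₃) ^ 2) ^ (p / 2)) ^ (1 / p)

/-- `φ(S) = ‖S‖_{2,p}^p`. -/
noncomputable def phi {a b c : ℕ} (p : ℝ) (S : Tensor3 a b c) : ℝ :=
  l2pNorm p S ^ p

/-- `ψ([G]) = ‖[G]‖_{1,w} = ∑ⱼ wⱼ ‖[G]^{(j)}‖₁`. -/
def psi {a b c N : ℕ} (w : Fin N → ℝ) (G : Tensor4 a b c N) : ℝ :=
  ∑ j : Fin N, w j * ∑ i₁ : Fin a, ∑ i₂ : Fin b, ∑ i₃ : Fin c, |G (i₁, i₂, i₃, j)|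

/-! ### Subdifferentials, proximal operators, projections -/

section Variational

/-- The Fréchet subdifferential of a real-valued function. The lower limit is taken in the extended
real numbers. -/
def frechetSubdiff {E : Type*} [NormedAddCommGroup E] [InnerProductSpace ℝ E]
    (f : E → ℝ) (x : E) : Set E :=
  {u | (0 : EReal) ≤
    liminf (fun y => (((f y - f x - inner ℝ u (y - x)) / ‖y - x‖ : ℝ) : EReal)) (𝓝[≠] x)}

/-- The limiting subdifferential of a real-valued function. -/
def limitingSubdiff {E : Type*} [NormedAddCommGroup E] [InnerProductSpace ℝ E]
    (f : E → ℝ) (x : E) : Set E :=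
  {u | ∃ (x' : ℕ → E) (u' : ℕ → E), Tendsto x' atTop (𝓝 x) ∧
    Tendsto (fun k => f (x' k)) atTop (𝓝 (f x)) ∧ Tendsto u' atTop (𝓝 u) ∧
    ∀ k, u' k ∈ frechetSubdiff f (x' k)}

/-- The (set-valued) proximal operator `prox_{λ f}(x)`. -/
def proxSet {E : Type*} [NormedAddCommGroup E] [InnerProductSpace ℝ E]
    (lam : ℝ) (f : E → ℝ) (x : E) : Set E :=
  {u | IsMinOn (fun v => f v + 1 / (2 * lam) * ‖v - x‖ ^ 2) Set.univ u}

end Variational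

/-- The Stiefel manifold `{X ∈ ℝ^{m × n} | Xᵀ X = I_n}`. -/
def stiefel (m n : ℕ) : Set (Matrix (Fin m) (Fin n) ℝ) :=
  {X | Xᵀ * X = 1}

/-- The squared Frobenius norm of a matrix. -/
def frobSq {m n : ℕ} (A : Matrix (Fin m) (Fin n) ℝ) : ℝ :=
  ∑ i : Fin m, ∑ j : Fin n, A i j ^ 2

/-- The (set-valued) projection onto the Stiefel manifold: all nearest points in Frobenius norm. -/
def stiefelProj {m n : ℕ} (A : Matrix (Fin m) (Fin n) ℝ) : Set (Matrix (Fin m) (Fin n) ℝ) :=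
  {X | X ∈ stiefel m n ∧ ∀ Y ∈ stiefel m n, frobSq (X - A) ≤ frobSq (Y - A)}

/-! ### The model, the algorithm and stationarity -/

/-- The data of the model: the noisy image `D`, the extraction operator `R`, the weight tensor `W`,
the parameters `δ`, `γ`, `p` and the weight vector `w`. No property is assumed here. -/
structure ModelData (I₁ I₂ I₃ m₁ m₂ m₃ N : ℕ) where
  D : Tensor3 I₁ I₂ I₃
  R : Tensor3 I₁ I₂ I₃ →ₗ[ℝ] Tensor4 m₁ m₂ m₃ N
  W : Tensor3 I₁ I₂ I₃
  δ : ℝ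
  γ : ℝ
  p : ℝ
  w : Fin N → ℝ

namespace ModelData

variable {I₁ I₂ I₃ m₁ m₂ m₃ N n₁ n₂ n₃ : ℕ}

/-- The standing conditions on the data; `LinearMap.adjoint M.R` is the transpose of `R` with
respect to the Frobenius inner products. -/
structure Admissible (M : ModelData I₁ I₂ I₃ m₁ m₂ m₃ N) : Prop where
  δ_pos : 0 < M.δ
  γ_pos : 0 < M.γ
  p_pos : 0 < M.p
  p_lt_one : M.p < 1
  w_pos : ∀ j, 0 < M.w j
  W_pos : ∀ i, 0 < M.W i
  adjoint_comp : ∀ T, LinearMap.adjoint M.R (M.R T) = tmul M.W T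

/-- `[Q₁] = ([G] ×₂ [X₂] ×₃ [X₃])_{[(1)]}`. -/
def Q1 (X₂ : MatStack m₂ n₂ N) (X₃ : MatStack m₃ n₃ N) (G : Tensor4 n₁ n₂ n₃ N) (j : Fin N) :
    Matrix (Fin n₁) (Fin m₂ × Fin m₃) ℝ :=
  unfold1 (modeProd3 (modeProd2 G X₂) X₃) j

/-- `[Q₂] = ([G] ×₁ [X₁] ×₃ [X₃])_{[(2)]}`. -/
def Q2 (X₁ : MatStack m₁ n₁ N) (X₃ : MatStack m₃ n₃ N) (G : Tensor4 n₁ n₂ n₃ N) (j : Fin N) :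
    Matrix (Fin n₂) (Fin m₁ × Fin m₃) ℝ :=
  unfold2 (modeProd3 (modeProd1 G X₁) X₃) j

/-- `[Q₃] = ([G] ×₁ [X₁] ×₂ [X₂])_{[(3)]}`. -/
def Q3 (X₁ : MatStack m₁ n₁ N) (X₂ : MatStack m₂ n₂ N) (G : Tensor4 n₁ n₂ n₃ N) (j : Fin N) :
    Matrix (Fin n₃) (Fin m₁ × Fin m₂) ℝ :=
  unfold3 (modeProd2 (modeProd1 G X₁) X₂) j

/-- `[O] = R(L) ×₁ [X₁]ᵀ ×₂ [X₂]ᵀ ×₃ [X₃]ᵀ`. -/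
def O (M : ModelData I₁ I₂ I₃ m₁ m₂ m₃ N) (X₁ : MatStack m₁ n₁ N) (X₂ : MatStack m₂ n₂ N)
    (X₃ : MatStack m₃ n₃ N) (L : Tensor3 I₁ I₂ I₃) : Tensor4 n₁ n₂ n₃ N :=
  modeProd3 (modeProd2 (modeProd1 (M.R L) (stackT X₁)) (stackT X₂)) (stackT X₃)

/-- `[Y] = [G] ×₁ [X₁] ×₂ [X₂] ×₃ [X₃]`. -/
def Y (X₁ : MatStack m₁ n₁ N) (X₂ : MatStack m₂ n₂ N) (X₃ : MatStack m₃ n₃ N)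
    (G : Tensor4 n₁ n₂ n₃ N) : Tensor4 m₁ m₂ m₃ N :=
  modeProd3 (modeProd2 (modeProd1 G X₁) X₂) X₃

/-- The sequence `(S k, [X₁ k], [X₂ k], [X₃ k], [G k], L k)` is generated by the proximal block
coordinate descent algorithm with parameters `αS`, `αX`, `αG`: the initial factors are feasible and
each iterate is one sweep of updates applied to the preceding one. -/
structure IsPBCD (M : ModelData I₁ I₂ I₃ m₁ m₂ m₃ N) (αS αX αG : ℝ)
    (S : ℕ → Tensor3 I₁ I₂ I₃) (X₁ : ℕ → MatStack m₁ n₁ N) (X₂ : ℕ → MatStack m₂ n₂ N)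
    (X₃ : ℕ → MatStack m₃ n₃ N) (G : ℕ → Tensor4 n₁ n₂ n₃ N) (L : ℕ → Tensor3 I₁ I₂ I₃) :
    Prop where
  init₁ : ∀ j, X₁ 0 j ∈ stiefel m₁ n₁
  init₂ : ∀ j, X₂ 0 j ∈ stiefel m₂ n₂
  init₃ : ∀ j, X₃ 0 j ∈ stiefel m₃ n₃
  S_update : ∀ k, ∃ V ∈ proxSet (M.γ / (M.δ + αS)) (phi M.p)
      (tmul (tsqrt M.W) (S k - (M.δ / (M.δ + αS)) • (S k + L k - M.D))),
    S (k + 1) = tmul (tinv (tsqrt M.W)) V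
  X₁_update : ∀ k j, X₁ (k + 1) j ∈ stiefelProj
    (X₁ k j - (1 / (1 + αX)) •
      (X₁ k j - unfold1 (M.R (L k)) j * (Q1 (X₂ k) (X₃ k) (G k) j)ᵀ))
  X₂_update : ∀ k j, X₂ (k + 1) j ∈ stiefelProj
    (X₂ k j - (1 / (1 + αX)) •
      (X₂ k j - unfold2 (M.R (L k)) j * (Q2 (X₁ (k + 1)) (X₃ k) (G k) j)ᵀ))
  X₃_update : ∀ k j, X₃ (k + 1) j ∈ stiefelProj
    (X₃ k j - (1 / (1 + αX)) •
      (X₃ k j - unfold3 (M.R (L k)) j * (Q3 (X₁ (k + 1)) (X₂ (k + 1)) (G k) j)ᵀ))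
  G_update : ∀ k, G (k + 1) ∈ proxSet (1 / (1 + αG)) (psi M.w)
    (G k - (1 / (1 + αG)) • (G k - M.O (X₁ (k + 1)) (X₂ (k + 1)) (X₃ (k + 1)) (L k)))
  L_update : ∀ k, L (k + 1) =
    (1 / (1 + M.δ)) • tmul (tinv M.W)
        (LinearMap.adjoint M.R (Y (X₁ (k + 1)) (X₂ (k + 1)) (X₃ (k + 1)) (G (k + 1))))
      + (1 - 1 / (1 + M.δ)) • (M.D - S (k + 1))

/-- Substationarity, symmetry and feasibility of a single Stiefel block `X`, where `H` is the
Euclidean partial gradient at the point considered. -/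
structure StiefelStationary {m n : ℕ} (X H : Matrix (Fin m) (Fin n) ℝ) : Prop where
  substationarity : 0 = (1 - X * Xᵀ) * H
  symmetry : 0 = Hᵀ * X - Xᵀ * H
  feasibility : Xᵀ * X = 1

/-- First-order stationary points of the model. The gradient of the coupling term with respect to
the block `[Xᵢ]` is `[Hᵢ] = ([Xᵢ] [Qᵢ] - [Pᵢ]) [Qᵢ]ᵀ` with `[Pᵢ] = (R(L))_{[(i)]}`. -/
structure IsFirstOrderStationary (M : ModelData I₁ I₂ I₃ m₁ m₂ m₃ N)
    (S : Tensor3 I₁ I₂ I₃) (X₁ : MatStack m₁ n₁ N) (X₂ : MatStack m₂ n₂ N)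
    (X₃ : MatStack m₃ n₃ N) (G : Tensor4 n₁ n₂ n₃ N) (L : Tensor3 I₁ I₂ I₃) : Prop where
  S_stationary : ∃ u ∈ limitingSubdiff (phi M.p) (tmul (tsqrt M.W) S),
    0 = M.δ • (L + S - M.D) + M.γ • tmul (tinv (tsqrt M.W)) u
  X₁_stationary : ∀ j, StiefelStationary (X₁ j)
    ((X₁ j * Q1 X₂ X₃ G j - unfold1 (M.R L) j) * (Q1 X₂ X₃ G j)ᵀ)
  X₂_stationary : ∀ j, StiefelStationary (X₂ j)
    ((X₂ j * Q2 X₁ X₃ G j - unfold2 (M.R L) j) * (Q2 X₁ X₃ G j)ᵀ)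
  X₃_stationary : ∀ j, StiefelStationary (X₃ j)
    ((X₃ j * Q3 X₁ X₂ G j - unfold3 (M.R L) j) * (Q3 X₁ X₂ G j)ᵀ)
  G_stationary : ∃ v ∈ limitingSubdiff (psi M.w) G, 0 = G - M.O X₁ X₂ X₃ L + v
  L_stationary : 0 = M.δ • (L + S - M.D) + L
    - tmul (tinv M.W) (LinearMap.adjoint M.R (Y X₁ X₂ X₃ G))

end ModelData

/-!
Every block update is an exact proximal step for the objective `F`, although it is written as a
linearized one. On points with `Xᵢᵀ Xᵢ = 1` the coupling term equals
`‖R L‖² / 2 - ⟪R L, Y⟫ + ‖G‖² / 2`, because mode products with such matrices are isometric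
(`norm_Y_sq`). It is therefore linear in each factor `Xᵢ`, where moreover the proximal term is
linear too since `‖Xᵢ‖` is constant (`stiefelProj_descent`), and has identity Hessian in `G`. As
`Rᵀ R` is multiplication by `W`, the data term has Hessian `δ` in the variable `√W ⊙ S`
(`proxSet_descent`), and the update of `L` is the exact minimization of a strongly convex quadratic
(`quadratic_eq_min_add`).

Hence one sweep decreases `F` by at least a positive definite quadratic form in the difference
of consecutive iterates (`IsPBCD.objective_descent`). As `F ≥ 0`, these differences tend to zero
(`IsPBCD.tendsto_sub`). Along an ultrafilter that realizes an accumulation point, both `Z k` and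
`Z (k + 1)` then converge to that point. The graphs of the proximal operators and of the projection
onto the Stiefel manifold are closed, so the accumulation point is a fixed point of every update.

The fixed point equations are the stationarity conditions: by Fermat's rule for the two proximal
steps (`neg_smul_mem_limitingSubdiff_of_mem_proxSet`), and for the factors because a maximizer `X`
of `⟪·, A⟫` on the Stiefel manifold makes `X * Aᵀ` symmetric, as one sees by moving `X` with plane
rotations (`mul_transpose_symm_of_mem_stiefelProj`).
-/

/-! ### Proximal steps in an inner product space -/

section Prox

variable {E : Type*} [NormedAddCommGroup E] [InnerProductSpace ℝ E]

theorem frechetSubdiff_subset_limitingSubdiff (f : E → ℝ) (x : E) :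
    frechetSubdiff f x ⊆ limitingSubdiff f x := fun u hu =>
  ⟨fun _ => x, fun _ => u, tendsto_const_nhds, tendsto_const_nhds, tendsto_const_nhds, fun _ => hu⟩

/-- Fermat's rule for the proximal operator: minimality bounds the difference quotient of `f` at
`u` from below by `-‖y - u‖ / (2 λ)`. -/
theorem smul_sub_mem_frechetSubdiff_of_mem_proxSet {lam : ℝ} {f : E → ℝ} {x u : E}
    (hu : u ∈ proxSet lam f x) : (1 / lam) • (x - u) ∈ frechetSubdiff f u := by
  have key : ∀ y, y ≠ u → -(1 / (2 * lam)) * ‖y - u‖ ≤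
      (f y - f u - inner ℝ ((1 / lam) • (x - u)) (y - u)) / ‖y - u‖ := by
    intro y hy
    have hpos : 0 < ‖y - u‖ := norm_pos_iff.2 (sub_ne_zero.2 hy)
    rw [le_div_iff₀ hpos]
    have hmin : f u + 1 / (2 * lam) * ‖u - x‖ ^ 2 ≤ f y + 1 / (2 * lam) * ‖y - x‖ ^ 2 :=
      hu (Set.mem_univ y)
    have hexp : ‖y - x‖ ^ 2 = ‖y - u‖ ^ 2 - 2 * inner ℝ (x - u) (y - u) + ‖u - x‖ ^ 2 := by
      rw [show y - x = (y - u) - (x - u) by abel, norm_sub_sq_real, real_inner_comm,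
        norm_sub_rev u x]
    rw [real_inner_smul_left]
    rw [hexp] at hmin
    have h2 : 1 / lam = 2 * (1 / (2 * lam)) := by
      rw [one_div, one_div, mul_inv]; ring
    rw [h2]
    nlinarith [hmin]
  have hlim : Tendsto (fun y => ((-(1 / (2 * lam)) * ‖y - u‖ : ℝ) : EReal)) (𝓝[≠] u)
      (𝓝 (0 : EReal)) := by
    have hc : Continuous (fun y : E => ((-(1 / (2 * lam)) * ‖y - u‖ : ℝ) : EReal)) :=
      continuous_coe_real_ereal.comp (by fun_prop)
    have := hc.tendsto u
    simp only [sub_self, norm_zero, mul_zero, EReal.coe_zero] at this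
    exact this.mono_left nhdsWithin_le_nhds
  change (0 : EReal) ≤ _
  refine le_of_forall_lt_imp_le_of_dense fun c hc => ?_
  refine le_liminf_of_le (by isBoundedDefault) ?_
  filter_upwards [hlim.eventually (lt_mem_nhds hc), self_mem_nhdsWithin] with y hy hyu
  exact hy.le.trans (EReal.coe_le_coe_iff.2 (key y hyu))

/-- The graph of the proximal operator of a continuous function is closed. -/
theorem mem_proxSet_of_tendsto {α : Type*} {l : Filter α} [l.NeBot] {lam : ℝ} {f : E → ℝ}
    (hf : Continuous f) {x u : α → E} {x₀ u₀ : E} (hu : Tendsto u l (𝓝 u₀))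
    (hx : Tendsto x l (𝓝 x₀)) (h : ∀ k, u k ∈ proxSet lam f (x k)) :
    u₀ ∈ proxSet lam f x₀ := by
  intro v _
  refine le_of_tendsto_of_tendsto' (f := fun k => f (u k) + 1 / (2 * lam) * ‖u k - x k‖ ^ 2)
    (g := fun k => f v + 1 / (2 * lam) * ‖v - x k‖ ^ 2) (b := l) ?_ ?_
    (fun k => h k (Set.mem_univ v))
  · exact ((hf.tendsto u₀).comp hu).add (((hu.sub hx).norm.pow 2).const_mul _)
  · exact tendsto_const_nhds.add (((tendsto_const_nhds.sub hx).norm.pow 2).const_mul _)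

/-- Since `v ↦ d / 2 * ‖v + b‖ ^ 2` has Hessian `d`, a proximal linearized step for it is an exact
proximal step, which decreases the sum with `c * f` by `α / 2 * ‖V - a‖ ^ 2`. -/
theorem proxSet_descent {c d α : ℝ} (hc : 0 < c) (hdα : 0 < d + α) {f : E → ℝ} {a b V : E}
    (hV : V ∈ proxSet (c / (d + α)) f (a - (d / (d + α)) • (a + b))) :
    c * f V + d / 2 * ‖V + b‖ ^ 2 + α / 2 * ‖V - a‖ ^ 2 ≤ c * f a + d / 2 * ‖a + b‖ ^ 2 := by
  have h : f V + 1 / (2 * (c / (d + α))) * ‖V - (a - (d / (d + α)) • (a + b))‖ ^ 2 ≤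
      f a + 1 / (2 * (c / (d + α))) * ‖a - (a - (d / (d + α)) • (a + b))‖ ^ 2 :=
    hV (Set.mem_univ a)
  rw [show V - (a - (d / (d + α)) • (a + b)) = (V - a) + (d / (d + α)) • (a + b) by abel,
    sub_sub_cancel, norm_add_sq_real, real_inner_smul_right] at h
  rw [show V + b = (V - a) + (a + b) by abel, norm_add_sq_real]
  have h2 := mul_le_mul_of_nonneg_left h hc.le
  have e : c * (1 / (2 * (c / (d + α)))) = (d + α) / 2 := by field_simp
  have e2 : (d + α) / 2 * (d / (d + α)) = d / 2 := by field_simp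
  have h3 : c * f V + (d + α) / 2 * ‖V - a‖ ^ 2 + 2 * ((d + α) / 2 * (d / (d + α))) *
      inner ℝ (V - a) (a + b) ≤ c * f a := by
    rw [← e]
    linarith
  rw [e2] at h3
  linarith

theorem neg_smul_mem_limitingSubdiff_of_mem_proxSet {c d α : ℝ} (hc : 0 < c) (hdα : 0 < d + α)
    {f : E → ℝ} {b V : E}
    (hV : V ∈ proxSet (c / (d + α)) f (V - (d / (d + α)) • (V + b))) :
    -((d / c) • (V + b)) ∈ limitingSubdiff f V := by
  have h := smul_sub_mem_frechetSubdiff_of_mem_proxSet hV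
  rw [sub_sub_cancel_left, smul_neg, smul_smul] at h
  have e : 1 / (c / (d + α)) * (d / (d + α)) = d / c := by field_simp
  rw [e] at h
  exact frechetSubdiff_subset_limitingSubdiff f V h

/-- Completing the square: `l₀` is the minimizer of the quadratic, whose Hessian is `1 + δ`. -/
theorem quadratic_eq_min_add {δ : ℝ} {l l₀ e y : E}
    (h : y = (1 + δ) • l₀ + δ • e) :
    δ / 2 * ‖l + e‖ ^ 2 + 1 / 2 * ‖l‖ ^ 2 - inner ℝ l y =
      δ / 2 * ‖l₀ + e‖ ^ 2 + 1 / 2 * ‖l₀‖ ^ 2 - inner ℝ l₀ y + (1 + δ) / 2 * ‖l₀ - l‖ ^ 2 := by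
  subst h
  rw [norm_add_sq_real, norm_add_sq_real, norm_sub_sq_real]
  simp only [inner_add_right, real_inner_smul_right, real_inner_self_eq_norm_sq]
  rw [real_inner_comm l l₀]
  ring

end Prox

/-! ### Projections onto the Stiefel manifold -/

section Stiefel

variable {m n : ℕ}

theorem frobSq_eq_trace (A : Matrix (Fin m) (Fin n) ℝ) : frobSq A = (Aᵀ * A).trace := by
  simp only [frobSq, trace, diag_apply, mul_apply, transpose_apply, ← pow_two]
  exact Finset.sum_comm

theorem frobSq_nonneg (A : Matrix (Fin m) (Fin n) ℝ) : 0 ≤ frobSq A :=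
  Finset.sum_nonneg fun _ _ => Finset.sum_nonneg fun _ _ => sq_nonneg _

theorem sq_entry_le_frobSq (A : Matrix (Fin m) (Fin n) ℝ) (i : Fin m) (j : Fin n) :
    A i j ^ 2 ≤ frobSq A :=
  (Finset.single_le_sum (f := fun j => A i j ^ 2) (fun _ _ => sq_nonneg _)
    (Finset.mem_univ j)).trans
    (Finset.single_le_sum (f := fun i => ∑ j, A i j ^ 2)
      (fun _ _ => Finset.sum_nonneg fun _ _ => sq_nonneg _) (Finset.mem_univ i))

theorem frobSq_sub (X A : Matrix (Fin m) (Fin n) ℝ) :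
    frobSq (X - A) = (Xᵀ * X).trace - 2 * (Xᵀ * A).trace + (Aᵀ * A).trace := by
  have h : (Aᵀ * X).trace = (Xᵀ * A).trace := by
    rw [← trace_transpose, transpose_mul, transpose_transpose]
  rw [frobSq_eq_trace, transpose_sub, Matrix.sub_mul, Matrix.mul_sub, Matrix.mul_sub, trace_sub,
    trace_sub, trace_sub, h]
  ring

/-- All points of the Stiefel manifold have the same norm, so a nearest point maximizes the inner
product. -/
theorem trace_le_of_mem_stiefelProj {X A Y : Matrix (Fin m) (Fin n) ℝ} (hX : X ∈ stiefelProj A)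
    (hY : Y ∈ stiefel m n) : (Yᵀ * A).trace ≤ (Xᵀ * A).trace := by
  have h := hX.2 Y hY
  have h1 : Xᵀ * X = 1 := hX.1
  have h2 : Yᵀ * Y = 1 := hY
  rw [frobSq_sub, frobSq_sub, h1, h2] at h
  linarith

theorem stiefelProj_descent {α : ℝ} (hα : 0 < α) {X Y B : Matrix (Fin m) (Fin n) ℝ}
    (hX : X ∈ stiefel m n) (hY : Y ∈ stiefelProj (X - (1 / (1 + α)) • (X - B))) :
    (Xᵀ * B).trace + α / 2 * frobSq (Y - X) ≤ (Yᵀ * B).trace := by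
  have h := trace_le_of_mem_stiefelProj hY hX
  have h1 : Xᵀ * X = 1 := hX
  have h2 : Yᵀ * Y = 1 := hY.1
  have hα' : 0 < 1 + α := by linarith
  rw [show X - (1 / (1 + α)) • (X - B) = (1 / (1 + α)) • (α • X + B) by
    ext i j
    simp only [Matrix.sub_apply, Matrix.smul_apply, Matrix.add_apply, smul_eq_mul]
    field_simp
    ring, Matrix.mul_smul, Matrix.mul_smul, trace_smul, trace_smul, smul_eq_mul,
    smul_eq_mul] at h
  have h3 := le_of_mul_le_mul_left h (by positivity)
  rw [Matrix.mul_add, Matrix.mul_add, trace_add, trace_add, Matrix.mul_smul, Matrix.mul_smul,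
    trace_smul, trace_smul, h1, smul_eq_mul, smul_eq_mul] at h3
  rw [frobSq_sub, h1, h2]
  linarith

/-- The plane rotation with cosine `c` and sine `s` in the coordinates `a ≠ b`. -/
def planeRotation (a b : Fin m) (c s : ℝ) : Matrix (Fin m) (Fin m) ℝ :=
  1 + (c - 1) • (single a a 1 + single b b 1) + s • (single a b 1 - single b a 1)

theorem planeRotation_transpose_mul_self {a b : Fin m} (hab : a ≠ b) {c s : ℝ}
    (h : c ^ 2 + s ^ 2 = 1) : (planeRotation a b c s)ᵀ * planeRotation a b c s = 1 := by
  set P : Matrix (Fin m) (Fin m) ℝ := single a a 1 + single b b 1 with hP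
  set J : Matrix (Fin m) (Fin m) ℝ := single a b 1 - single b a 1 with hJ
  have hPT : Pᵀ = P := by simp [hP]
  have hJT : Jᵀ = -J := by simp [hJ]
  have hPP : P * P = P := by simp [hP, Matrix.mul_add, Matrix.add_mul, hab, hab.symm]
  have hPJ : P * J = J := by simp [hP, hJ, Matrix.mul_sub, Matrix.add_mul, hab, hab.symm]
  have hJP : J * P = J := by simp [hP, hJ, Matrix.mul_add, Matrix.sub_mul, hab, hab.symm]; abel
  have hJJ : J * J = -P := by simp [hP, hJ, Matrix.mul_sub, Matrix.sub_mul, hab, hab.symm]; abel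
  have hU : planeRotation a b c s = 1 + (c - 1) • P + s • J := rfl
  have hs : s ^ 2 = 1 - c ^ 2 := by linarith
  rw [hU, transpose_add, transpose_add, transpose_smul, transpose_smul, hPT, hJT, transpose_one]
  simp only [Matrix.mul_add, Matrix.add_mul, Matrix.mul_one, Matrix.one_mul, Matrix.smul_mul,
    Matrix.mul_smul, Matrix.neg_mul, smul_neg, hPP, hPJ, hJP, hJJ, neg_neg]
  have hsP : s • s • P = (1 - c ^ 2) • P := by rw [← hs, pow_two, smul_smul]
  rw [smul_add s, hsP]
  module

/-- First order optimality on the Stiefel manifold. Left multiplication by plane rotations moves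
`X` along the manifold, and the derivatives of the inner product with `A` along these curves are
the entries of `A * Xᵀ - X * Aᵀ`. -/
theorem mul_transpose_symm_of_mem_stiefelProj {X A : Matrix (Fin m) (Fin n) ℝ}
    (hX : X ∈ stiefelProj A) : X * Aᵀ = A * Xᵀ := by
  have htr : ∀ U : Matrix (Fin m) (Fin m) ℝ, ((U * X)ᵀ * A).trace = (U * (X * Aᵀ)).trace := by
    intro U
    rw [← trace_transpose, transpose_mul, transpose_transpose, trace_mul_comm, Matrix.mul_assoc]
  set B := X * Aᵀ with hB
  have hBT : A * Xᵀ = Bᵀ := by rw [hB, transpose_mul, transpose_transpose]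
  have hX1 : Xᵀ * X = 1 := hX.1
  rw [hBT]
  ext a b
  rw [transpose_apply]
  rcases eq_or_ne a b with rfl | hab
  · rfl
  -- the rational parametrization of the circle makes the optimality condition polynomial in `t`
  have key : ∀ t : ℝ, t * (B b a - B a b) ≤ t ^ 2 * (B a a + B b b) := by
    intro t
    have ht : 0 < 1 + t ^ 2 := by positivity
    set c := (1 - t ^ 2) / (1 + t ^ 2) with hc
    set s := 2 * t / (1 + t ^ 2) with hs
    have hcs : c ^ 2 + s ^ 2 = 1 := by rw [hc, hs]; field_simp; ring
    have hmem : planeRotation a b c s * X ∈ stiefel m n := by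
      change (planeRotation a b c s * X)ᵀ * (planeRotation a b c s * X) = 1
      rw [transpose_mul, Matrix.mul_assoc, ← Matrix.mul_assoc _ _ X,
        planeRotation_transpose_mul_self hab hcs, Matrix.one_mul, hX1]
    have h := trace_le_of_mem_stiefelProj hX hmem
    have h1 := htr 1
    rw [Matrix.one_mul, Matrix.one_mul] at h1
    rw [htr, h1, planeRotation] at h
    simp only [Matrix.add_mul, Matrix.sub_mul, Matrix.smul_mul, trace_add,
      trace_sub, trace_smul, smul_eq_mul, Matrix.trace_single_mul, one_mul] at h
    have hc1 : (c - 1) * (1 + t ^ 2) = - 2 * t ^ 2 := by rw [hc]; field_simp; ring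
    have hs1 : s * (1 + t ^ 2) = 2 * t := by rw [hs]; field_simp
    have h5 : ((c - 1) * (B a a + B b b) + s * (B b a - B a b)) * (1 + t ^ 2) ≤ 0 :=
      mul_nonpos_of_nonpos_of_nonneg (by linarith) ht.le
    have h6 : ((c - 1) * (B a a + B b b) + s * (B b a - B a b)) * (1 + t ^ 2) =
      ((c - 1) * (1 + t ^ 2)) * (B a a + B b b) + (s * (1 + t ^ 2)) * (B b a - B a b) := by ring
    rw [h6, hc1, hs1] at h5
    linarith
  -- a linear term dominated near `0` by a quadratic one vanishes
  have hle : ∀ q r : ℝ, (∀ t : ℝ, t * q ≤ t ^ 2 * r) → q ≤ 0 := by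
    intro q r h
    by_contra hq
    push Not at hq
    have hr : 0 < |r| + 1 := by positivity
    have h1 := h (q / (2 * (|r| + 1)))
    set t := q / (2 * (|r| + 1)) with ht
    have ht0 : 0 < t := by positivity
    have h2 : t * (2 * (|r| + 1)) = q := by rw [ht]; field_simp
    have h3 : q ≤ t * r := le_of_mul_le_mul_left (by linarith : t * q ≤ t * (t * r)) ht0
    nlinarith [le_abs_self r]
  have h1 := hle _ _ key
  have h2 := hle (-(B b a - B a b)) (B a a + B b b) (fun t => by
    have := key (-t)
    linarith [neg_sq t ▸ this])
  linarith

/-- At a fixed point of the projected step, the Euclidean gradient `(X * Q - P) * Qᵀ` satisfies the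
stationarity conditions. -/
theorem stiefelStationary_of_mem_stiefelProj {ι : Type*} [Fintype ι] {α : ℝ} (hα : 0 < α)
    {X : Matrix (Fin m) (Fin n) ℝ} {P : Matrix (Fin m) ι ℝ} {Q : Matrix (Fin n) ι ℝ}
    (hX : X ∈ stiefelProj (X - (1 / (1 + α)) • (X - P * Qᵀ))) :
    ModelData.StiefelStationary X ((X * Q - P) * Qᵀ) := by
  have hX1 : Xᵀ * X = 1 := hX.1
  have hs := mul_transpose_symm_of_mem_stiefelProj hX
  set H := (X * Q - P) * Qᵀ with hH
  set B := P * Qᵀ with hB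
  have hα' : (1 / (1 + α)) ≠ 0 := by positivity
  have hBs : X * Bᵀ = B * Xᵀ := by
    simp only [transpose_sub, transpose_smul, Matrix.mul_sub, Matrix.sub_mul, Matrix.mul_smul,
      Matrix.smul_mul, smul_sub] at hs
    have : (1 / (1 + α)) • (X * Bᵀ) = (1 / (1 + α)) • (B * Xᵀ) := by
      simpa using hs
    exact smul_right_injective _ hα' this
  have hHB : H = X * (Q * Qᵀ) - B := by rw [hH, Matrix.sub_mul, Matrix.mul_assoc]
  have hHs : X * Hᵀ = H * Xᵀ := by
    rw [hHB, transpose_sub, Matrix.mul_sub, Matrix.sub_mul, hBs, transpose_mul, transpose_mul,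
      transpose_transpose, Matrix.mul_assoc X]
  have hHX : H = X * (Hᵀ * X) := by
    rw [← Matrix.mul_assoc, hHs, Matrix.mul_assoc, hX1, Matrix.mul_one]
  have hXH : Xᵀ * H = Hᵀ * X := by
    conv_lhs => rw [hHX]
    rw [← Matrix.mul_assoc, hX1, Matrix.one_mul]
  refine ⟨?_, ?_, hX1⟩
  · rw [Matrix.sub_mul, Matrix.one_mul, Matrix.mul_assoc, hXH, ← hHX, sub_self]
  · rw [hXH, sub_self]

theorem continuous_frobSq : Continuous (frobSq : Matrix (Fin m) (Fin n) ℝ → ℝ) := by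
  unfold frobSq
  fun_prop

theorem mem_stiefelProj_of_tendsto {α : Type*} {l : Filter α} [l.NeBot]
    {X A : α → Matrix (Fin m) (Fin n) ℝ} {X₀ A₀ : Matrix (Fin m) (Fin n) ℝ}
    (hX : Tendsto X l (𝓝 X₀)) (hA : Tendsto A l (𝓝 A₀)) (h : ∀ k, X k ∈ stiefelProj (A k)) :
    X₀ ∈ stiefelProj A₀ := by
  refine ⟨?_, fun Y hY => ?_⟩
  · have hc : Continuous fun X : Matrix (Fin m) (Fin n) ℝ => Xᵀ * X := by fun_prop
    have h1 : Tendsto (fun k => (X k)ᵀ * X k) l (𝓝 (X₀ᵀ * X₀)) := (hc.tendsto X₀).comp hX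
    have h2 : (fun k => (X k)ᵀ * X k) = fun _ => 1 := funext fun k => (h k).1
    rw [h2] at h1
    exact (tendsto_nhds_unique h1 tendsto_const_nhds)
  · exact le_of_tendsto_of_tendsto' ((continuous_frobSq.tendsto _).comp (hX.sub hA))
      ((continuous_frobSq.tendsto _).comp ((tendsto_const_nhds (x := Y)).sub hA))
      (fun k => (h k).2 Y hY)

theorem tendsto_zero_of_frobSq {α : Type*} {l : Filter α} {A : α → Matrix (Fin m) (Fin n) ℝ}
    (h : Tendsto (fun k => frobSq (A k)) l (𝓝 0)) : Tendsto A l (𝓝 0) := by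
  refine tendsto_pi_nhds.2 fun i => tendsto_pi_nhds.2 fun j => ?_
  have h1 : Tendsto (fun k => A k i j ^ 2) l (𝓝 0) :=
    squeeze_zero (fun _ => sq_nonneg _) (fun k => sq_entry_le_frobSq (A k) i j) h
  have h2 : Tendsto (fun k => |A k i j|) l (𝓝 0) := by
    simpa [Real.sqrt_sq_eq_abs] using h1.sqrt
  exact (tendsto_zero_iff_abs_tendsto_zero _).2 h2

end Stiefel

/-! ### Componentwise operations on tensors -/

section Componentwise

variable {ι : Type*}

@[simp] theorem tmul_apply (A B : EuclideanSpace ℝ ι) (i : ι) : tmul A B i = A i * B i := rfl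

@[simp] theorem tsqrt_apply (A : EuclideanSpace ℝ ι) (i : ι) : tsqrt A i = √(A i) := rfl

@[simp] theorem tinv_apply (A : EuclideanSpace ℝ ι) (i : ι) : tinv A i = (A i)⁻¹ := rfl

theorem tmul_add (A B C : EuclideanSpace ℝ ι) : tmul A (B + C) = tmul A B + tmul A C := by
  ext i; simp [mul_add]

theorem tmul_sub (A B C : EuclideanSpace ℝ ι) : tmul A (B - C) = tmul A B - tmul A C := by
  ext i; simp [mul_sub]

theorem tmul_smul (A B : EuclideanSpace ℝ ι) (c : ℝ) : tmul A (c • B) = c • tmul A B := by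
  ext i; simp [mul_left_comm]

theorem tmul_tinv_cancel {A : EuclideanSpace ℝ ι} (hA : ∀ i, 0 < A i) (B : EuclideanSpace ℝ ι) :
    tmul A (tmul (tinv A) B) = B := by
  ext i
  have := (hA i).ne'
  simp [this]

theorem tinv_tmul_cancel {A : EuclideanSpace ℝ ι} (hA : ∀ i, 0 < A i) (B : EuclideanSpace ℝ ι) :
    tmul (tinv A) (tmul A B) = B := by
  ext i
  have := (hA i).ne'
  simp [this]

theorem tsqrt_pos {A : EuclideanSpace ℝ ι} (hA : ∀ i, 0 < A i) (i : ι) : 0 < tsqrt A i :=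
  Real.sqrt_pos.2 (hA i)

theorem continuous_tmul (A : EuclideanSpace ℝ ι) : Continuous (tmul A) := by
  unfold tmul
  fun_prop

theorem inner_tmul_left [Fintype ι] (A B C : EuclideanSpace ℝ ι) :
    inner ℝ (tmul A B) C = inner ℝ B (tmul A C) := by
  simp only [PiLp.inner_apply, tmul_apply, RCLike.inner_apply, conj_trivial]
  exact Finset.sum_congr rfl fun i _ => by ring

theorem tmul_tsqrt_tmul_tsqrt {A : EuclideanSpace ℝ ι} (hA : ∀ i, 0 < A i)
    (B : EuclideanSpace ℝ ι) : tmul (tsqrt A) (tmul (tsqrt A) B) = tmul A B := by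
  ext i
  simp [← mul_assoc, Real.mul_self_sqrt (hA i).le]

end Componentwise

/-! ### Mode products and unfoldings -/

section ModeProducts

variable {a b c N a' b' c' : ℕ}

theorem modeProd12_comm (G : Tensor4 a b c N) (X : MatStack a' a N) (Y : MatStack b' b N) :
    modeProd2 (modeProd1 G X) Y = modeProd1 (modeProd2 G Y) X := by
  ext q
  simp only [modeProd1, modeProd2, Finset.mul_sum]
  rw [Finset.sum_comm]
  exact Finset.sum_congr rfl fun _ _ => Finset.sum_congr rfl fun _ _ => by ring

theorem modeProd13_comm (G : Tensor4 a b c N) (X : MatStack a' a N) (Y : MatStack c' c N) :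
    modeProd3 (modeProd1 G X) Y = modeProd1 (modeProd3 G Y) X := by
  ext q
  simp only [modeProd1, modeProd3, Finset.mul_sum]
  rw [Finset.sum_comm]
  exact Finset.sum_congr rfl fun _ _ => Finset.sum_congr rfl fun _ _ => by ring

theorem modeProd23_comm (G : Tensor4 a b c N) (X : MatStack b' b N) (Y : MatStack c' c N) :
    modeProd3 (modeProd2 G X) Y = modeProd2 (modeProd3 G Y) X := by
  ext q
  simp only [modeProd2, modeProd3, Finset.mul_sum]
  rw [Finset.sum_comm]
  exact Finset.sum_congr rfl fun _ _ => Finset.sum_congr rfl fun _ _ => by ring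

theorem unfold1_modeProd1 (G : Tensor4 a b c N) (X : MatStack a' a N) (j : Fin N) :
    unfold1 (modeProd1 G X) j = X j * unfold1 G j := by
  ext i q; simp [unfold1, modeProd1, mul_apply]

theorem unfold2_modeProd2 (G : Tensor4 a b c N) (X : MatStack b' b N) (j : Fin N) :
    unfold2 (modeProd2 G X) j = X j * unfold2 G j := by
  ext i q; simp [unfold2, modeProd2, mul_apply]

theorem unfold3_modeProd3 (G : Tensor4 a b c N) (X : MatStack c' c N) (j : Fin N) :
    unfold3 (modeProd3 G X) j = X j * unfold3 G j := by
  ext i q; simp [unfold3, modeProd3, mul_apply]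

theorem inner_eq_unfold1 (T T' : Tensor4 a b c N) :
    inner ℝ T T' = ∑ j, ((unfold1 T j)ᵀ * unfold1 T' j).trace := by
  simp only [PiLp.inner_apply, RCLike.inner_apply, conj_trivial, Fintype.sum_prod_type, trace,
    diag_apply, mul_apply, transpose_apply, unfold1, of_apply]
  have h : ∀ (j : Fin N), ∑ i₂, ∑ i₃, ∑ i₁, T (i₁, i₂, i₃, j) * T' (i₁, i₂, i₃, j) =
      ∑ i₁, ∑ i₂, ∑ i₃, T (i₁, i₂, i₃, j) * T' (i₁, i₂, i₃, j) := by
    intro j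
    rw [Finset.sum_comm (s := (Finset.univ : Finset (Fin a)))]
    exact Finset.sum_congr rfl fun i₂ _ => Finset.sum_comm
  simp only [h]
  rw [Finset.sum_comm (s := (Finset.univ : Finset (Fin N)))]
  refine Finset.sum_congr rfl fun i₁ _ => ?_
  rw [Finset.sum_comm (s := (Finset.univ : Finset (Fin N)))]
  refine Finset.sum_congr rfl fun i₂ _ => ?_
  rw [Finset.sum_comm (s := (Finset.univ : Finset (Fin N)))]
  exact Finset.sum_congr rfl fun i₃ _ => Finset.sum_congr rfl fun j _ => mul_comm _ _

theorem inner_eq_unfold2 (T T' : Tensor4 a b c N) :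
    inner ℝ T T' = ∑ j, ((unfold2 T j)ᵀ * unfold2 T' j).trace := by
  rw [inner_eq_unfold1]
  refine Finset.sum_congr rfl fun j _ => ?_
  simp only [Fintype.sum_prod_type, trace, diag_apply, mul_apply, transpose_apply, unfold1,
    unfold2, of_apply]
  rw [Finset.sum_comm]
  rw [Finset.sum_comm (s := (Finset.univ : Finset (Fin a)))]
  refine Finset.sum_congr rfl fun i₃ _ => ?_
  exact Finset.sum_comm

theorem inner_eq_unfold3 (T T' : Tensor4 a b c N) :
    inner ℝ T T' = ∑ j, ((unfold3 T j)ᵀ * unfold3 T' j).trace := by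
  rw [inner_eq_unfold1]
  refine Finset.sum_congr rfl fun j _ => ?_
  simp only [Fintype.sum_prod_type, trace, diag_apply, mul_apply, transpose_apply, unfold1,
    unfold3, of_apply]
  rw [Finset.sum_comm (s := (Finset.univ : Finset (Fin a)))]
  refine Finset.sum_congr rfl fun i₂ _ => ?_
  exact Finset.sum_comm

theorem inner_modeProd1 (G : Tensor4 a b c N) (X : MatStack a' a N) (T : Tensor4 a' b c N) :
    inner ℝ T (modeProd1 G X) = inner ℝ (modeProd1 T (stackT X)) G := by
  simp only [inner_eq_unfold1, unfold1_modeProd1, stackT, transpose_mul, transpose_transpose,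
    Matrix.mul_assoc]

theorem inner_modeProd2 (G : Tensor4 a b c N) (X : MatStack b' b N) (T : Tensor4 a b' c N) :
    inner ℝ T (modeProd2 G X) = inner ℝ (modeProd2 T (stackT X)) G := by
  simp only [inner_eq_unfold2, unfold2_modeProd2, stackT, transpose_mul, transpose_transpose,
    Matrix.mul_assoc]

theorem inner_modeProd3 (G : Tensor4 a b c N) (X : MatStack c' c N) (T : Tensor4 a b c' N) :
    inner ℝ T (modeProd3 G X) = inner ℝ (modeProd3 T (stackT X)) G := by
  simp only [inner_eq_unfold3, unfold3_modeProd3, stackT, transpose_mul, transpose_transpose,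
    Matrix.mul_assoc]

theorem modeProd1_stackT_cancel (G : Tensor4 a b c N) {X : MatStack a' a N}
    (hX : ∀ j, X j ∈ stiefel a' a) : modeProd1 (modeProd1 G X) (stackT X) = G := by
  ext ⟨i₁, i₂, i₃, j⟩
  have h := unfold1_modeProd1 (modeProd1 G X) (stackT X) j
  have hj : (X j)ᵀ * X j = 1 := hX j
  rw [unfold1_modeProd1 G, stackT, ← Matrix.mul_assoc, hj, Matrix.one_mul] at h
  exact congrFun (congrFun h i₁) (i₂, i₃)

theorem modeProd2_stackT_cancel (G : Tensor4 a b c N) {X : MatStack b' b N}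
    (hX : ∀ j, X j ∈ stiefel b' b) : modeProd2 (modeProd2 G X) (stackT X) = G := by
  ext ⟨i₁, i₂, i₃, j⟩
  have h := unfold2_modeProd2 (modeProd2 G X) (stackT X) j
  have hj : (X j)ᵀ * X j = 1 := hX j
  rw [unfold2_modeProd2 G, stackT, ← Matrix.mul_assoc, hj, Matrix.one_mul] at h
  exact congrFun (congrFun h i₂) (i₁, i₃)

theorem modeProd3_stackT_cancel (G : Tensor4 a b c N) {X : MatStack c' c N}
    (hX : ∀ j, X j ∈ stiefel c' c) : modeProd3 (modeProd3 G X) (stackT X) = G := by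
  ext ⟨i₁, i₂, i₃, j⟩
  have h := unfold3_modeProd3 (modeProd3 G X) (stackT X) j
  have hj : (X j)ᵀ * X j = 1 := hX j
  rw [unfold3_modeProd3 G, stackT, ← Matrix.mul_assoc, hj, Matrix.one_mul] at h
  exact congrFun (congrFun h i₃) (i₁, i₂)

end ModeProducts

/-! ### The nonsmooth terms -/

section Nonsmooth

variable {a b c N : ℕ}

theorem continuous_phi {p : ℝ} (hp : 0 < p) : Continuous (phi (a := a) (b := b) (c := c) p) := by
  unfold phi l2pNorm
  refine Continuous.rpow_const (Continuous.rpow_const ?_ fun _ => Or.inr (by positivity))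
    fun _ => Or.inr hp.le
  refine continuous_finsetSum _ fun i₃ _ => continuous_finsetSum _ fun i₂ _ => ?_
  exact Continuous.rpow_const (by fun_prop) fun _ => Or.inr (by positivity)

theorem phi_nonneg (p : ℝ) (S : Tensor3 a b c) : 0 ≤ phi p S := by
  unfold phi l2pNorm
  positivity

theorem continuous_psi (w : Fin N → ℝ) : Continuous (psi (a := a) (b := b) (c := c) w) := by
  unfold psi
  fun_prop

theorem psi_nonneg {w : Fin N → ℝ} (hw : ∀ j, 0 < w j) (G : Tensor4 a b c N) : 0 ≤ psi w G :=
  Finset.sum_nonneg fun j _ => mul_nonneg (hw j).le <| by positivity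

end Nonsmooth

namespace ModelData

variable {I₁ I₂ I₃ m₁ m₂ m₃ N n₁ n₂ n₃ : ℕ}

/-! ### The coupling term -/

section Coupling

theorem unfold1_Y (X₁ : MatStack m₁ n₁ N) (X₂ : MatStack m₂ n₂ N) (X₃ : MatStack m₃ n₃ N)
    (G : Tensor4 n₁ n₂ n₃ N) (j : Fin N) :
    unfold1 (Y X₁ X₂ X₃ G) j = X₁ j * Q1 X₂ X₃ G j := by
  rw [Y, modeProd12_comm, modeProd13_comm, unfold1_modeProd1, Q1]

theorem unfold2_Y (X₁ : MatStack m₁ n₁ N) (X₂ : MatStack m₂ n₂ N) (X₃ : MatStack m₃ n₃ N)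
    (G : Tensor4 n₁ n₂ n₃ N) (j : Fin N) :
    unfold2 (Y X₁ X₂ X₃ G) j = X₂ j * Q2 X₁ X₃ G j := by
  rw [Y, modeProd23_comm, unfold2_modeProd2, Q2]

theorem unfold3_Y (X₁ : MatStack m₁ n₁ N) (X₂ : MatStack m₂ n₂ N) (X₃ : MatStack m₃ n₃ N)
    (G : Tensor4 n₁ n₂ n₃ N) (j : Fin N) :
    unfold3 (Y X₁ X₂ X₃ G) j = X₃ j * Q3 X₁ X₂ G j := by
  rw [Y, unfold3_modeProd3, Q3]

theorem trace_transpose_mul_mul {m n : ℕ} {ι : Type*} [Fintype ι] (P : Matrix (Fin m) ι ℝ)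
    (X : Matrix (Fin m) (Fin n) ℝ) (Q : Matrix (Fin n) ι ℝ) :
    (Pᵀ * (X * Q)).trace = (Xᵀ * (P * Qᵀ)).trace := by
  rw [← trace_transpose, transpose_mul, transpose_transpose, transpose_mul, Matrix.mul_assoc,
    trace_mul_comm, Matrix.mul_assoc]

theorem inner_Y_eq_sum₁ (T : Tensor4 m₁ m₂ m₃ N) (X₁ : MatStack m₁ n₁ N) (X₂ : MatStack m₂ n₂ N)
    (X₃ : MatStack m₃ n₃ N) (G : Tensor4 n₁ n₂ n₃ N) : inner ℝ T (Y X₁ X₂ X₃ G) =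
      ∑ j, ((X₁ j)ᵀ * (unfold1 T j * (Q1 X₂ X₃ G j)ᵀ)).trace := by
  simp only [inner_eq_unfold1, unfold1_Y, trace_transpose_mul_mul]

theorem inner_Y_eq_sum₂ (T : Tensor4 m₁ m₂ m₃ N) (X₁ : MatStack m₁ n₁ N) (X₂ : MatStack m₂ n₂ N)
    (X₃ : MatStack m₃ n₃ N) (G : Tensor4 n₁ n₂ n₃ N) : inner ℝ T (Y X₁ X₂ X₃ G) =
      ∑ j, ((X₂ j)ᵀ * (unfold2 T j * (Q2 X₁ X₃ G j)ᵀ)).trace := by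
  simp only [inner_eq_unfold2, unfold2_Y, trace_transpose_mul_mul]

theorem inner_Y_eq_sum₃ (T : Tensor4 m₁ m₂ m₃ N) (X₁ : MatStack m₁ n₁ N) (X₂ : MatStack m₂ n₂ N)
    (X₃ : MatStack m₃ n₃ N) (G : Tensor4 n₁ n₂ n₃ N) : inner ℝ T (Y X₁ X₂ X₃ G) =
      ∑ j, ((X₃ j)ᵀ * (unfold3 T j * (Q3 X₁ X₂ G j)ᵀ)).trace := by
  simp only [inner_eq_unfold3, unfold3_Y, trace_transpose_mul_mul]

theorem inner_R_Y (M : ModelData I₁ I₂ I₃ m₁ m₂ m₃ N) (X₁ : MatStack m₁ n₁ N)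
    (X₂ : MatStack m₂ n₂ N) (X₃ : MatStack m₃ n₃ N) (G : Tensor4 n₁ n₂ n₃ N)
    (L : Tensor3 I₁ I₂ I₃) :
    inner ℝ (M.R L) (Y X₁ X₂ X₃ G) = inner ℝ G (M.O X₁ X₂ X₃ L) := by
  rw [Y, inner_modeProd3, inner_modeProd2, inner_modeProd1, real_inner_comm, O,
    ← modeProd12_comm, ← modeProd13_comm, ← modeProd23_comm]

/-- Mode products with matrices with orthonormal columns are isometric. -/
theorem norm_Y_sq {X₁ : MatStack m₁ n₁ N} {X₂ : MatStack m₂ n₂ N} {X₃ : MatStack m₃ n₃ N}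
    (h₁ : ∀ j, X₁ j ∈ stiefel m₁ n₁) (h₂ : ∀ j, X₂ j ∈ stiefel m₂ n₂)
    (h₃ : ∀ j, X₃ j ∈ stiefel m₃ n₃) (G : Tensor4 n₁ n₂ n₃ N) :
    ‖Y X₁ X₂ X₃ G‖ ^ 2 = ‖G‖ ^ 2 := by
  rw [← real_inner_self_eq_norm_sq, ← real_inner_self_eq_norm_sq, Y, inner_modeProd3,
    modeProd3_stackT_cancel _ h₃, inner_modeProd2, modeProd2_stackT_cancel _ h₂, inner_modeProd1,
    modeProd1_stackT_cancel _ h₁]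

end Coupling

/-! ### Sufficient decrease of the objective -/

section Descent

/-- The objective function of the model. -/
noncomputable def objective (M : ModelData I₁ I₂ I₃ m₁ m₂ m₃ N) (S : Tensor3 I₁ I₂ I₃)
    (X₁ : MatStack m₁ n₁ N) (X₂ : MatStack m₂ n₂ N) (X₃ : MatStack m₃ n₃ N)
    (G : Tensor4 n₁ n₂ n₃ N) (L : Tensor3 I₁ I₂ I₃) : ℝ :=
  M.δ / 2 * ‖M.R (L + S - M.D)‖ ^ 2 + M.γ * phi M.p (tmul (tsqrt M.W) S) + psi M.w G
    + 1 / 2 * ‖M.R L - Y X₁ X₂ X₃ G‖ ^ 2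

variable {M : ModelData I₁ I₂ I₃ m₁ m₂ m₃ N}

theorem Admissible.objective_nonneg (hM : M.Admissible) (S : Tensor3 I₁ I₂ I₃)
    (X₁ : MatStack m₁ n₁ N) (X₂ : MatStack m₂ n₂ N) (X₃ : MatStack m₃ n₃ N)
    (G : Tensor4 n₁ n₂ n₃ N) (L : Tensor3 I₁ I₂ I₃) : 0 ≤ M.objective S X₁ X₂ X₃ G L := by
  have h1 := phi_nonneg M.p (tmul (tsqrt M.W) S)
  have h2 := psi_nonneg hM.w_pos G
  have h3 := hM.δ_pos
  have h4 := hM.γ_pos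
  unfold objective
  positivity

/-- As `Rᵀ R` is multiplication by `W`, the operator `R` is isometric after rescaling by `√W`. -/
theorem Admissible.norm_R_sq (hM : M.Admissible) (T : Tensor3 I₁ I₂ I₃) :
    ‖M.R T‖ ^ 2 = ‖tmul (tsqrt M.W) T‖ ^ 2 := by
  rw [← real_inner_self_eq_norm_sq, ← real_inner_self_eq_norm_sq, ← LinearMap.adjoint_inner_right,
    hM.adjoint_comp, inner_tmul_left, tmul_tsqrt_tmul_tsqrt hM.W_pos]

/-- On feasible points the coupling term is linear in each factor and a quadratic with identity
Hessian in the core tensor. -/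
theorem Admissible.objective_eq (hM : M.Admissible) (S : Tensor3 I₁ I₂ I₃)
    {X₁ : MatStack m₁ n₁ N} {X₂ : MatStack m₂ n₂ N} {X₃ : MatStack m₃ n₃ N}
    (h₁ : ∀ j, X₁ j ∈ stiefel m₁ n₁) (h₂ : ∀ j, X₂ j ∈ stiefel m₂ n₂)
    (h₃ : ∀ j, X₃ j ∈ stiefel m₃ n₃) (G : Tensor4 n₁ n₂ n₃ N) (L : Tensor3 I₁ I₂ I₃) :
    M.objective S X₁ X₂ X₃ G L =
      M.δ / 2 * ‖tmul (tsqrt M.W) S + tmul (tsqrt M.W) (L - M.D)‖ ^ 2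
      + M.γ * phi M.p (tmul (tsqrt M.W) S) + psi M.w G
      + 1 / 2 * ‖tmul (tsqrt M.W) L‖ ^ 2 - inner ℝ (M.R L) (Y X₁ X₂ X₃ G) + 1 / 2 * ‖G‖ ^ 2 := by
  rw [objective, norm_sub_sq_real, norm_Y_sq h₁ h₂ h₃, hM.norm_R_sq, hM.norm_R_sq, ← tmul_add,
    show S + (L - M.D) = L + S - M.D by abel]
  ring

variable {αS αX αG : ℝ} {S : ℕ → Tensor3 I₁ I₂ I₃} {X₁ : ℕ → MatStack m₁ n₁ N}
  {X₂ : ℕ → MatStack m₂ n₂ N} {X₃ : ℕ → MatStack m₃ n₃ N} {G : ℕ → Tensor4 n₁ n₂ n₃ N}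
  {L : ℕ → Tensor3 I₁ I₂ I₃}

theorem IsPBCD.mem_stiefel₁ (hZ : M.IsPBCD αS αX αG S X₁ X₂ X₃ G L) :
    ∀ k j, X₁ k j ∈ stiefel m₁ n₁
  | 0, j => hZ.init₁ j
  | k + 1, j => (hZ.X₁_update k j).1

theorem IsPBCD.mem_stiefel₂ (hZ : M.IsPBCD αS αX αG S X₁ X₂ X₃ G L) :
    ∀ k j, X₂ k j ∈ stiefel m₂ n₂
  | 0, j => hZ.init₂ j
  | k + 1, j => (hZ.X₂_update k j).1

theorem IsPBCD.mem_stiefel₃ (hZ : M.IsPBCD αS αX αG S X₁ X₂ X₃ G L) :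
    ∀ k j, X₃ k j ∈ stiefel m₃ n₃
  | 0, j => hZ.init₃ j
  | k + 1, j => (hZ.X₃_update k j).1

/-- In the variable `√W ⊙ S` the update of `S` is a proximal linearized step. -/
theorem IsPBCD.tmul_S_mem_proxSet (hM : M.Admissible) (hZ : M.IsPBCD αS αX αG S X₁ X₂ X₃ G L)
    (k : ℕ) : tmul (tsqrt M.W) (S (k + 1)) ∈ proxSet (M.γ / (M.δ + αS)) (phi M.p)
      (tmul (tsqrt M.W) (S k) - (M.δ / (M.δ + αS)) •
        (tmul (tsqrt M.W) (S k) + tmul (tsqrt M.W) (L k - M.D))) := by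
  obtain ⟨V, hV, hS⟩ := hZ.S_update k
  rw [hS, tmul_tinv_cancel (tsqrt_pos hM.W_pos), ← tmul_add, ← tmul_smul, ← tmul_sub,
    show S k + (L k - M.D) = S k + L k - M.D by abel]
  exact hV

/-- The guaranteed decrease of the objective in the sweep from iterate `k` to `k + 1`: a weighted
sum of the squared differences of the blocks. -/
noncomputable def decrease (M : ModelData I₁ I₂ I₃ m₁ m₂ m₃ N) (αS αX αG : ℝ)
    (S : ℕ → Tensor3 I₁ I₂ I₃) (X₁ : ℕ → MatStack m₁ n₁ N) (X₂ : ℕ → MatStack m₂ n₂ N)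
    (X₃ : ℕ → MatStack m₃ n₃ N) (G : ℕ → Tensor4 n₁ n₂ n₃ N) (L : ℕ → Tensor3 I₁ I₂ I₃) (k : ℕ) :
    ℝ :=
  αS / 2 * ‖tmul (tsqrt M.W) (S (k + 1) - S k)‖ ^ 2
    + αX / 2 * ∑ j, frobSq (X₁ (k + 1) j - X₁ k j) + αX / 2 * ∑ j, frobSq (X₂ (k + 1) j - X₂ k j)
    + αX / 2 * ∑ j, frobSq (X₃ (k + 1) j - X₃ k j) + αG / 2 * ‖G (k + 1) - G k‖ ^ 2
    + (1 + M.δ) / 2 * ‖tmul (tsqrt M.W) (L (k + 1) - L k)‖ ^ 2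

theorem sum_stiefelProj_descent {m n : ℕ} {α : ℝ} (hα : 0 < α) {X X' B : MatStack m n N}
    (hX : ∀ j, X j ∈ stiefel m n)
    (hX' : ∀ j, X' j ∈ stiefelProj (X j - (1 / (1 + α)) • (X j - B j))) :
    ∑ j, ((X j)ᵀ * B j).trace + α / 2 * ∑ j, frobSq (X' j - X j) ≤
      ∑ j, ((X' j)ᵀ * B j).trace := by
  rw [Finset.mul_sum, ← Finset.sum_add_distrib]
  exact Finset.sum_le_sum fun j _ => stiefelProj_descent hα (hX j) (hX' j)

theorem IsPBCD.objective_descent (hM : M.Admissible) (hαS : 0 < αS) (hαX : 0 < αX) (hαG : 0 < αG)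
    (hZ : M.IsPBCD αS αX αG S X₁ X₂ X₃ G L) (k : ℕ) :
    M.objective (S (k + 1)) (X₁ (k + 1)) (X₂ (k + 1)) (X₃ (k + 1)) (G (k + 1)) (L (k + 1))
      + decrease M αS αX αG S X₁ X₂ X₃ G L k ≤
      M.objective (S k) (X₁ k) (X₂ k) (X₃ k) (G k) (L k) := by
  have hδ := hM.δ_pos
  have hS := proxSet_descent hM.γ_pos (by positivity) (hZ.tmul_S_mem_proxSet hM k)
  have hX₁ := sum_stiefelProj_descent hαX (hZ.mem_stiefel₁ k) (hZ.X₁_update k)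
  have hX₂ := sum_stiefelProj_descent hαX (hZ.mem_stiefel₂ k) (hZ.X₂_update k)
  have hX₃ := sum_stiefelProj_descent hαX (hZ.mem_stiefel₃ k) (hZ.X₃_update k)
  rw [← inner_Y_eq_sum₁, ← inner_Y_eq_sum₁] at hX₁
  rw [← inner_Y_eq_sum₂, ← inner_Y_eq_sum₂] at hX₂
  rw [← inner_Y_eq_sum₃, ← inner_Y_eq_sum₃] at hX₃
  have hG := hZ.G_update k
  rw [sub_eq_add_neg (G k) (M.O _ _ _ _)] at hG
  have hG := proxSet_descent one_pos (by positivity) hG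
  rw [← sub_eq_add_neg, ← sub_eq_add_neg, norm_sub_sq_real (G (k + 1)) (M.O _ _ _ _),
    norm_sub_sq_real (G k) (M.O _ _ _ _), ← inner_R_Y, ← inner_R_Y] at hG
  -- the exact minimization over `L`, in the variable `√W ⊙ L`
  set y := tmul (tinv (tsqrt M.W)) (LinearMap.adjoint M.R
    (Y (X₁ (k + 1)) (X₂ (k + 1)) (X₃ (k + 1)) (G (k + 1)))) with hy
  have hyL : y = (1 + M.δ) • tmul (tsqrt M.W) (L (k + 1))
      + M.δ • tmul (tsqrt M.W) (S (k + 1) - M.D) := by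
    rw [hZ.L_update k, hy]
    ext i
    have hWi := hM.W_pos i
    have hs := (Real.sqrt_pos.2 hWi).ne'
    have hss := (Real.sq_sqrt hWi.le).symm
    simp only [tmul_apply, tsqrt_apply, tinv_apply, PiLp.add_apply, PiLp.smul_apply,
      PiLp.sub_apply, smul_eq_mul]
    generalize √(M.W i) = s at hs hss
    rw [hss]
    field_simp
    ring
  have hinner : ∀ T, inner ℝ (tmul (tsqrt M.W) T) y =
      inner ℝ (M.R T) (Y (X₁ (k + 1)) (X₂ (k + 1)) (X₃ (k + 1)) (G (k + 1))) := by
    intro T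
    rw [inner_tmul_left, hy, tmul_tinv_cancel (tsqrt_pos hM.W_pos), LinearMap.adjoint_inner_right]
  have hL := quadratic_eq_min_add (l := tmul (tsqrt M.W) (L k)) hyL
  rw [hinner, hinner, ← tmul_add, ← tmul_add, ← tmul_sub] at hL
  rw [hM.objective_eq _ (hZ.mem_stiefel₁ _) (hZ.mem_stiefel₂ _) (hZ.mem_stiefel₃ _),
    hM.objective_eq _ (hZ.mem_stiefel₁ _) (hZ.mem_stiefel₂ _) (hZ.mem_stiefel₃ _), decrease,
    ← tmul_add, ← tmul_add]
  rw [← tmul_add, ← tmul_add, ← tmul_sub] at hS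
  have e : ∀ k l, L k + (S l - M.D) = S l + (L k - M.D) := fun k l => by abel
  rw [e, e] at hL
  linarith

theorem IsPBCD.tendsto_decrease (hM : M.Admissible) (hαS : 0 < αS) (hαX : 0 < αX) (hαG : 0 < αG)
    (hZ : M.IsPBCD αS αX αG S X₁ X₂ X₃ G L) :
    Tendsto (decrease M αS αX αG S X₁ X₂ X₃ G L) atTop (𝓝 0) := by
  have hdesc := hZ.objective_descent hM hαS hαX hαG
  set F : ℕ → ℝ := fun k => M.objective (S k) (X₁ k) (X₂ k) (X₃ k) (G k) (L k) with hF
  have hδ := hM.δ_pos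
  have hnn : ∀ k, 0 ≤ decrease M αS αX αG S X₁ X₂ X₃ G L k := by
    intro k
    have h : ∀ {m n : ℕ} (A : MatStack m n N), 0 ≤ ∑ j, frobSq (A j) :=
      fun A => Finset.sum_nonneg fun j _ => frobSq_nonneg _
    have h1 := h (X₁ (k + 1) - X₁ k)
    have h2 := h (X₂ (k + 1) - X₂ k)
    have h3 := h (X₃ (k + 1) - X₃ k)
    simp only [Pi.sub_apply] at h1 h2 h3
    unfold decrease
    positivity
  have hanti : Antitone F := antitone_nat_of_succ_le fun k => by linarith [hdesc k, hnn k]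
  have hlim := tendsto_atTop_ciInf hanti
    ⟨0, by rintro _ ⟨k, rfl⟩; exact hM.objective_nonneg _ _ _ _ _ _⟩
  have hdiff := hlim.sub (hlim.comp (tendsto_add_atTop_nat 1))
  rw [sub_self] at hdiff
  exact squeeze_zero hnn (fun k => by
    change _ ≤ F k - F (k + 1)
    linarith [hdesc k]) hdiff

end Descent

/-! ### Passage to the limit -/

section Limit

variable {M : ModelData I₁ I₂ I₃ m₁ m₂ m₃ N} {αS αX αG : ℝ} {S : ℕ → Tensor3 I₁ I₂ I₃}
  {X₁ : ℕ → MatStack m₁ n₁ N} {X₂ : ℕ → MatStack m₂ n₂ N} {X₃ : ℕ → MatStack m₃ n₃ N}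
  {G : ℕ → Tensor4 n₁ n₂ n₃ N} {L : ℕ → Tensor3 I₁ I₂ I₃}

theorem tendsto_zero_of_sq_norm {E : Type*} [NormedAddCommGroup E] {u : ℕ → E}
    (h : Tendsto (fun k => ‖u k‖ ^ 2) atTop (𝓝 0)) : Tendsto u atTop (𝓝 0) := by
  refine tendsto_zero_iff_norm_tendsto_zero.2 ?_
  simpa [Real.sqrt_sq_eq_abs] using h.sqrt

theorem tendsto_zero_of_tmul {ι : Type*} [Fintype ι] {A : EuclideanSpace ℝ ι}
    (hA : ∀ i, 0 < A i) {u : ℕ → EuclideanSpace ℝ ι}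
    (h : Tendsto (fun k => ‖tmul A (u k)‖ ^ 2) atTop (𝓝 0)) : Tendsto u atTop (𝓝 0) := by
  have h1 := ((continuous_tmul (tinv A)).tendsto 0).comp (tendsto_zero_of_sq_norm h)
  have h2 : tmul (tinv A) 0 = 0 := by ext i; simp
  rw [h2] at h1
  exact h1.congr fun k => tinv_tmul_cancel hA (u k)

theorem tendsto_zero_of_sum_frobSq {m n : ℕ} {u : ℕ → MatStack m n N}
    (h : Tendsto (fun k => ∑ j, frobSq (u k j)) atTop (𝓝 0)) : Tendsto u atTop (𝓝 0) :=
  tendsto_pi_nhds.2 fun j => tendsto_zero_of_frobSq <| squeeze_zero (fun _ => frobSq_nonneg _)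
    (fun k => Finset.single_le_sum (f := fun j => frobSq (u k j)) (fun _ _ => frobSq_nonneg _)
      (Finset.mem_univ j)) h

/-- Consecutive iterates are asymptotically equal. -/
theorem IsPBCD.tendsto_sub (hM : M.Admissible) (hαS : 0 < αS) (hαX : 0 < αX) (hαG : 0 < αG)
    (hZ : M.IsPBCD αS αX αG S X₁ X₂ X₃ G L) :
    Tendsto (fun k => S (k + 1) - S k) atTop (𝓝 0) ∧
    Tendsto (fun k => X₁ (k + 1) - X₁ k) atTop (𝓝 0) ∧
    Tendsto (fun k => X₂ (k + 1) - X₂ k) atTop (𝓝 0) ∧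
    Tendsto (fun k => X₃ (k + 1) - X₃ k) atTop (𝓝 0) ∧
    Tendsto (fun k => G (k + 1) - G k) atTop (𝓝 0) ∧
    Tendsto (fun k => L (k + 1) - L k) atTop (𝓝 0) := by
  have hd := hZ.tendsto_decrease hM hαS hαX hαG
  have hδ := hM.δ_pos
  have hW := tsqrt_pos hM.W_pos
  have hfrob : ∀ {m n : ℕ} (X : ℕ → MatStack m n N) (k : ℕ),
      0 ≤ ∑ j, frobSq (X (k + 1) j - X k j) :=
    fun X k => Finset.sum_nonneg fun j _ => frobSq_nonneg _
  -- each summand of the decrease is dominated by the whole sum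
  have hterm : ∀ {c : ℝ} (t : ℕ → ℝ), 0 < c → (∀ k, 0 ≤ t k) →
      (∀ k, c * t k ≤ decrease M αS αX αG S X₁ X₂ X₃ G L k) → Tendsto t atTop (𝓝 0) := by
    intro c t hc ht h
    have := hd.const_mul c⁻¹
    rw [mul_zero] at this
    refine squeeze_zero ht (fun k => ?_) this
    rw [inv_mul_eq_div, le_div_iff₀ hc, mul_comm]
    exact h k
  have hle : ∀ k, 0 ≤ αS / 2 * ‖tmul (tsqrt M.W) (S (k + 1) - S k)‖ ^ 2 ∧
      0 ≤ αX / 2 * ∑ j, frobSq (X₁ (k + 1) j - X₁ k j) ∧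
      0 ≤ αX / 2 * ∑ j, frobSq (X₂ (k + 1) j - X₂ k j) ∧
      0 ≤ αX / 2 * ∑ j, frobSq (X₃ (k + 1) j - X₃ k j) ∧
      0 ≤ αG / 2 * ‖G (k + 1) - G k‖ ^ 2 ∧
      0 ≤ (1 + M.δ) / 2 * ‖tmul (tsqrt M.W) (L (k + 1) - L k)‖ ^ 2 := by
    intro k
    have h1 := hfrob X₁ k
    have h2 := hfrob X₂ k
    have h3 := hfrob X₃ k
    refine ⟨?_, ?_, ?_, ?_, ?_, ?_⟩ <;> positivity
  refine ⟨tendsto_zero_of_tmul hW (hterm (c := αS / 2) _ (by positivity) (by intro; positivity) ?_),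
    tendsto_zero_of_sum_frobSq (hterm (c := αX / 2) _ (by positivity) (hfrob X₁) ?_),
    tendsto_zero_of_sum_frobSq (hterm (c := αX / 2) _ (by positivity) (hfrob X₂) ?_),
    tendsto_zero_of_sum_frobSq (hterm (c := αX / 2) _ (by positivity) (hfrob X₃) ?_),
    tendsto_zero_of_sq_norm (hterm (c := αG / 2) _ (by positivity) (by intro; positivity) ?_),
    tendsto_zero_of_tmul hW
      (hterm (c := (1 + M.δ) / 2) _ (by positivity) (by intro; positivity) ?_)⟩ <;>
  · intro k
    obtain ⟨h1, h2, h3, h4, h5, h6⟩ := hle k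
    dsimp only [decrease, Pi.sub_apply]
    linarith

theorem continuous_unfold1_mul_Q1 (M : ModelData I₁ I₂ I₃ m₁ m₂ m₃ N) (j : Fin N) :
    Continuous fun z : MatStack m₂ n₂ N × MatStack m₃ n₃ N × Tensor4 n₁ n₂ n₃ N ×
      Tensor3 I₁ I₂ I₃ => unfold1 (M.R z.2.2.2) j * (Q1 z.1 z.2.1 z.2.2.1 j)ᵀ := by
  have hR : Continuous M.R := M.R.continuous_of_finiteDimensional
  unfold Q1 unfold1 modeProd3 modeProd2
  fun_prop

theorem continuous_unfold2_mul_Q2 (M : ModelData I₁ I₂ I₃ m₁ m₂ m₃ N) (j : Fin N) :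
    Continuous fun z : MatStack m₁ n₁ N × MatStack m₃ n₃ N × Tensor4 n₁ n₂ n₃ N ×
      Tensor3 I₁ I₂ I₃ => unfold2 (M.R z.2.2.2) j * (Q2 z.1 z.2.1 z.2.2.1 j)ᵀ := by
  have hR : Continuous M.R := M.R.continuous_of_finiteDimensional
  unfold Q2 unfold2 modeProd3 modeProd1
  fun_prop

theorem continuous_unfold3_mul_Q3 (M : ModelData I₁ I₂ I₃ m₁ m₂ m₃ N) (j : Fin N) :
    Continuous fun z : MatStack m₁ n₁ N × MatStack m₂ n₂ N × Tensor4 n₁ n₂ n₃ N ×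
      Tensor3 I₁ I₂ I₃ => unfold3 (M.R z.2.2.2) j * (Q3 z.1 z.2.1 z.2.2.1 j)ᵀ := by
  have hR : Continuous M.R := M.R.continuous_of_finiteDimensional
  unfold Q3 unfold3 modeProd2 modeProd1
  fun_prop

theorem continuous_O (M : ModelData I₁ I₂ I₃ m₁ m₂ m₃ N) :
    Continuous fun z : MatStack m₁ n₁ N × MatStack m₂ n₂ N × MatStack m₃ n₃ N ×
      Tensor3 I₁ I₂ I₃ => M.O z.1 z.2.1 z.2.2.1 z.2.2.2 := by
  have hR : Continuous M.R := M.R.continuous_of_finiteDimensional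
  unfold O modeProd3 modeProd2 modeProd1 stackT
  fun_prop

theorem continuous_Y :
    Continuous fun z : MatStack m₁ n₁ N × MatStack m₂ n₂ N × MatStack m₃ n₃ N ×
      Tensor4 n₁ n₂ n₃ N => Y z.1 z.2.1 z.2.2.1 z.2.2.2 := by
  unfold Y modeProd3 modeProd2 modeProd1
  fun_prop

end Limit

end ModelData

theorem mainTheorem1 {I₁ I₂ I₃ m₁ m₂ m₃ n₁ n₂ n₃ N : ℕ}
    (M : ModelData I₁ I₂ I₃ m₁ m₂ m₃ N) (hM : M.Admissible)
    (αS αX αG : ℝ) (hαS : 0 < αS) (hαX : 0 < αX) (hαG : 0 < αG)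
    (S : ℕ → Tensor3 I₁ I₂ I₃) (X₁ : ℕ → MatStack m₁ n₁ N) (X₂ : ℕ → MatStack m₂ n₂ N)
    (X₃ : ℕ → MatStack m₃ n₃ N) (G : ℕ → Tensor4 n₁ n₂ n₃ N) (L : ℕ → Tensor3 I₁ I₂ I₃)
    (hZ : M.IsPBCD αS αX αG S X₁ X₂ X₃ G L)
    (S' : Tensor3 I₁ I₂ I₃) (X₁' : MatStack m₁ n₁ N) (X₂' : MatStack m₂ n₂ N)
    (X₃' : MatStack m₃ n₃ N) (G' : Tensor4 n₁ n₂ n₃ N) (L' : Tensor3 I₁ I₂ I₃)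
    (hacc : MapClusterPt (S', X₁', X₂', X₃', G', L') atTop
      (fun k => (S k, X₁ k, X₂ k, X₃ k, G k, L k))) :
    M.IsFirstOrderStationary S' X₁' X₂' X₃' G' L' := by
  have hδ := hM.δ_pos
  have hγ := hM.γ_pos
  -- along an ultrafilter both `Z k` and, as the differences vanish, `Z (k + 1)` converge
  obtain ⟨U, hU, hlim⟩ := mapClusterPt_iff_ultrafilter.1 hacc
  obtain ⟨hS, hlim⟩ := Prod.tendsto_iff _ _ |>.1 hlim
  obtain ⟨hX₁, hlim⟩ := Prod.tendsto_iff _ _ |>.1 hlim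
  obtain ⟨hX₂, hlim⟩ := Prod.tendsto_iff _ _ |>.1 hlim
  obtain ⟨hX₃, hlim⟩ := Prod.tendsto_iff _ _ |>.1 hlim
  obtain ⟨hG, hL⟩ := Prod.tendsto_iff _ _ |>.1 hlim
  dsimp only at hS hX₁ hX₂ hX₃ hG hL
  obtain ⟨dS, dX₁, dX₂, dX₃, dG, dL⟩ := hZ.tendsto_sub hM hαS hαX hαG
  have hS1 : Tendsto (fun k => S (k + 1)) U (𝓝 S') := by simpa using (dS.mono_left hU).add hS
  have hX₁1 : Tendsto (fun k => X₁ (k + 1)) U (𝓝 X₁') := by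
    simpa using (dX₁.mono_left hU).add hX₁
  have hX₂1 : Tendsto (fun k => X₂ (k + 1)) U (𝓝 X₂') := by
    simpa using (dX₂.mono_left hU).add hX₂
  have hX₃1 : Tendsto (fun k => X₃ (k + 1)) U (𝓝 X₃') := by
    simpa using (dX₃.mono_left hU).add hX₃
  have hG1 : Tendsto (fun k => G (k + 1)) U (𝓝 G') := by simpa using (dG.mono_left hU).add hG
  have hL1 : Tendsto (fun k => L (k + 1)) U (𝓝 L') := by simpa using (dL.mono_left hU).add hL
  refine ⟨?_, ?_, ?_, ?_, ?_, ?_⟩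
  · have hsqrt := continuous_tmul (tsqrt M.W)
    have hS2 := (hsqrt.tendsto S').comp hS
    have hprox := mem_proxSet_of_tendsto (continuous_phi hM.p_pos) ((hsqrt.tendsto S').comp hS1)
      (hS2.sub ((hS2.add ((hsqrt.tendsto (L' - M.D)).comp (hL.sub_const M.D))).const_smul
        (M.δ / (M.δ + αS)))) (hZ.tmul_S_mem_proxSet hM)
    refine ⟨_, neg_smul_mem_limitingSubdiff_of_mem_proxSet hγ (by positivity) hprox, ?_⟩
    ext i
    have hs := (Real.sqrt_pos.2 (hM.W_pos i)).ne'
    simp only [tmul_apply, tsqrt_apply, tinv_apply, PiLp.add_apply, PiLp.smul_apply,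
      PiLp.sub_apply, PiLp.neg_apply, PiLp.zero_apply, smul_eq_mul]
    field_simp
    ring
  · intro j
    have hA := ((ModelData.continuous_unfold1_mul_Q1 M j).tendsto (X₂', X₃', G', L')).comp
      (hX₂.prodMk_nhds (hX₃.prodMk_nhds (hG.prodMk_nhds hL)))
    have hXj := tendsto_pi_nhds.1 hX₁ j
    exact stiefelStationary_of_mem_stiefelProj hαX (mem_stiefelProj_of_tendsto
      (tendsto_pi_nhds.1 hX₁1 j) (hXj.sub ((hXj.sub hA).const_smul (1 / (1 + αX))))
      (fun k => hZ.X₁_update k j))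
  · intro j
    have hA := ((ModelData.continuous_unfold2_mul_Q2 M j).tendsto (X₁', X₃', G', L')).comp
      (hX₁1.prodMk_nhds (hX₃.prodMk_nhds (hG.prodMk_nhds hL)))
    have hXj := tendsto_pi_nhds.1 hX₂ j
    exact stiefelStationary_of_mem_stiefelProj hαX (mem_stiefelProj_of_tendsto
      (tendsto_pi_nhds.1 hX₂1 j) (hXj.sub ((hXj.sub hA).const_smul (1 / (1 + αX))))
      (fun k => hZ.X₂_update k j))
  · intro j
    have hA := ((ModelData.continuous_unfold3_mul_Q3 M j).tendsto (X₁', X₂', G', L')).comp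
      (hX₁1.prodMk_nhds (hX₂1.prodMk_nhds (hG.prodMk_nhds hL)))
    have hXj := tendsto_pi_nhds.1 hX₃ j
    exact stiefelStationary_of_mem_stiefelProj hαX (mem_stiefelProj_of_tendsto
      (tendsto_pi_nhds.1 hX₃1 j) (hXj.sub ((hXj.sub hA).const_smul (1 / (1 + αX))))
      (fun k => hZ.X₃_update k j))
  · have hO := ((ModelData.continuous_O M).tendsto (X₁', X₂', X₃', L')).comp
      (hX₁1.prodMk_nhds (hX₂1.prodMk_nhds (hX₃1.prodMk_nhds hL)))
    have hprox := mem_proxSet_of_tendsto (continuous_psi M.w) hG1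
      (hG.sub ((hG.sub hO).const_smul (1 / (1 + αG)))) hZ.G_update
    dsimp only at hprox
    rw [sub_eq_add_neg G' (M.O _ _ _ _)] at hprox
    refine ⟨_, neg_smul_mem_limitingSubdiff_of_mem_proxSet one_pos (by positivity) hprox, ?_⟩
    rw [div_one, one_smul]
    abel
  · have hY := (ModelData.continuous_Y.tendsto (X₁', X₂', X₃', G')).comp
      (hX₁1.prodMk_nhds (hX₂1.prodMk_nhds (hX₃1.prodMk_nhds hG1)))
    have hRT := ((LinearMap.adjoint M.R).continuous_of_finiteDimensional.tendsto _).comp hY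
    have hLlim := ((((continuous_tmul (tinv M.W)).tendsto _).comp hRT).const_smul
      (1 / (1 + M.δ))).add (((tendsto_const_nhds (x := M.D)).sub hS1).const_smul
        (1 - 1 / (1 + M.δ)))
    have hLeq := tendsto_nhds_unique hL1 (hLlim.congr fun k => (hZ.L_update k).symm)
    dsimp only at hLeq
    ext i
    have hi := congrArg (fun T : Tensor3 I₁ I₂ I₃ => T i) hLeq
    simp only [PiLp.add_apply, PiLp.smul_apply, PiLp.sub_apply, PiLp.zero_apply,
      smul_eq_mul] at hi ⊢
    field_simp at hi
    linarith
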